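/- Let $f(n)=\lfloor (n-1)/3\rfloor$ and $Q(n)=\lceil 2n/3\rceil$. IBFT-M1 is the following blockchain protocol. All nodes share a genesis block of height $0$; each honest node $v$ keeps a chain of finalised blocks (a finalised block is a block $B$ with a set of commit seals, i.e. signatures of the hash of $B$), and $h_v$ is the next height. The validator set of instance $h$ is a function of the blocks of heights $0,\dots,h-1$; $n_h$ is its size; the proposer of a round is a function of these blocks and the round, and in any $n_h$ consecutive rounds every validator is proposer once. Validity $\mathrm{Valid}(B,P)$ of a block $B$ with parent $P$ forces $B$ to have the height of $P$ plus one and includes the check that a finalisation proof can be added to $B$. A finalised block is valid for $v$ if at least $Q(n_{h_v})$ of its seals are signatures of its block by validators of instance $h_v$ and its block is valid with the last block of $v$'s chain as parent; $v$ appends a received valid finalised block of height $h_v$, stops instance $h_v$, and starts the next instance if it is a validator. Nodes regularly query the other nodes for new finalised blocks, which are sent in answer. A validator $v$ in instance $h=h_v$ starts unlocked by starting round $0$. When it starts round $r$ it has accepted no block, resets its "Commit sent" and "finalised block sent" flags and sets a timer of length $T_0 2^r$; the proposer sends Pre-Prepare$(h,r,B)$ with $B$ its locked block, or any valid block if it is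 not locked. All these messages are signed by the sender and multicast to the validators. In round $r$: (1) having accepted no block and received the proposer's Pre-Prepare$(h,r,B)$, $v$ accepts $B$ and sends Prepare$(h,r,\mathrm{hash}\,B)$ if $B$ is valid and $v$ is unlocked or locked on $B$, and otherwise moves to round $r+1$; (2) having sent no Commit and received $Q(n_h)$ matching Prepare messages from validators, it locks on its accepted block; (3) having sent no Commit, being locked on $B$ and having received the proposer's Pre-Prepare for $B$ or some validator's Prepare for $B$ in round $r$, it sends Commit$(h,r,\mathrm{hash}\,B,\text{its seal of }B)$; (4) having sent no finalised block and received Commit messages of round $r$ for its accepted block $B$ from $Q(n_h)$ distinct senders, each with a seal of $B$ signed by its sender, it locks on $B$ and sends $B$ with these seals as a finalised block to all nodes; (5) on $f(n_h)+1$ Round-Change messages of validators for one round $r'>r$ it moves to $r'$; (6) when the timer of round $r$ expires it moves to $r+1$; (7) on $Q(n_h)$ Round-Change messages of validators for one round $r'>r$, or $r'=r$ if $r$ was not started, it starts $r'$. Moving to a round resets the accepted block to none and sends a Round-Change message for it. A lock is never released during an instance. Messages may be delayed arbitrarily or lost. Byzantine nodes collude and act arbitrarily, except that they cannot forge message signatures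 or commit seals of honest nodes; hashing is collision-free, a seal determines the hash and the signer, and each signer has exactly one seal of a given hash. **Theorem.** IBFT-M1 guarantees the Byzantine-fault-tolerant persistence threshold $f$: 1. (Safety of every instance.) Let $h\ge 1$, and suppose that all honest validators of instance $h$ agree on the validator set, of size $n_h$, and that at most $f(n_h)$ of its members are Byzantine. Call a finalised block *produced by instance $h$* if some node, honest or Byzantine, has sent it and at least $Q(n_h)$ validators have in it a seal of its block that they sent in a Commit message of instance $h$. Every finalised block produced by instance $h$ has height $h$ and is valid with respect to the chain up to height $h-1$ of some honest node; and any two finalised blocks of height $h$ sent by any nodes, each with at least $Q(n_h)$ seals of its block by validators of instance $h$, contain the same block. (By definition, this property for all instances is the *optimal persistence threshold*; $f$ is called optimal because of the known bound for consensus in eventually synchronous networks.) 2. (Persistence.) Suppose that for each instance $h \ge 1$ that an honest node $v$ reaches, at most $f(n)$ of the $n$ validators determined by $v$'s chain are Byzantine. If an honest node has transaction $T$ at position $(h,k)$ of its ledger (the $k$-th transaction of the block of height $h$), then (i) no honest node ever has another transaction at that position. Moreover (ii) every honest node eventually has $T$ at that position, provided that the network is eventually synchronous (from some time on, messages to honest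 nodes are delivered within a bounded delay) and honest nodes keep running: each eventually starts, eventually appends a finalised block if a suitable valid one stays available, sends infinitely many queries, and answers queries for finalised blocks that it has. -/

import Mathlib

/-! # The IBFT-M1 protocol: model, adversary, safety and persistence -/

namespace IBFT

open Filter

/-- The number of Byzantine nodes tolerated among `n` nodes, `f(n) = ⌊(n - 1) / 3⌋`
(so `f(0) = -1`: the bound cannot be met by an empty validator set). -/
def maxFaulty (n : ℕ) : ℤ := ⌊((n : ℚ) - 1) / 3⌋

/-- The quorum size `⌈2n / 3⌉`. -/
def quorumOpt (n : ℕ) : ℕ := ⌈(2 * (n : ℚ)) / 3⌉₊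

/-- The ingredients the protocol is built on: blocks, validator and proposer selection, a hash
function and a signature scheme, with their standing assumptions. -/
structure Setting (Node Block Tx Hash Sig : Type*) where
  genesis : Block
  height : Block → ℕ
  height_genesis : height genesis = 0
  /-- the transactions of a block, in order -/
  txs : Block → List Tx
  /-- `ethValid B P`: `B` is a valid Ethereum block with parent `P` -/
  ethValid : Block → Block → Prop
  height_of_ethValid : ∀ B P, ethValid B P → height B = height P + 1
  /-- a finalisation proof can be added to the block -/
  wellFormedToAddFinalProof : Block → Prop
  /-- the validators of instance `h`, computed from the blocks of heights `0, …, h - 1` -/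
  validators : List Block → Finset Node
  /-- the proposer of a round of instance `h`, computed from the blocks of heights `0, …, h - 1` -/
  proposer : List Block → ℕ → Node
  /-- any `n_h` consecutive rounds give every validator a turn -/
  proposer_turn : ∀ c r, ∀ v ∈ validators c, ∃ i < (validators c).card, proposer c (r + i) = v
  keccak : Block → Hash
  /-- collision resistance, idealised -/
  keccak_injective : Function.Injective keccak
  sign : Hash → Node → Sig
  /-- signer of a signature of the given hash; `none` if the signature is not one of that hash -/
  recover : Hash → Sig → Option Node
  recover_eq_some_iff : ∀ H s v, recover H s = some v ↔ s = sign H v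
  /-- uniqueness: signatures of different hashes are different -/
  sign_unique : ∀ H H' v v', sign H v = sign H' v' → H = H'
  timeoutForRoundZero : ℝ
  timeoutForRoundZero_pos : 0 < timeoutForRoundZero

/-- A block together with a finalisation proof (a set of commit seals). -/
structure FinalisedBlock (Block Sig : Type*) where
  block : Block
  proof : Finset Sig

/-- Contents of the messages that are signed by their sender. -/
inductive Content (Block Hash Sig : Type*) where
  | prePrepare (h r : ℕ) (B : Block)
  | prepare (h r : ℕ) (H : Hash)
  | commit (h r : ℕ) (H : Hash) (cs : Sig)
  | roundChange (h r : ℕ)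

/-- Messages. `signed c v` is the content `c` carrying the signature of `v`; `query h v` is a
request, to be answered to `v`, for the finalised block of height `h`. -/
inductive Msg (Node Block Hash Sig : Type*) where
  | signed (c : Content Block Hash Sig) (sender : Node)
  | finalisedBlock (FB : FinalisedBlock Block Sig)
  | query (h : ℕ) (requester : Node)

/-- The commit seals that occur in a message. -/
def Msg.seals {Node Block Hash Sig : Type*} : Msg Node Block Hash Sig → Set Sig
  | .signed (.commit _ _ _ cs) _ => {cs}
  | .signed _ _ => ∅
  | .finalisedBlock FB => {cs | cs ∈ FB.proof}
  | .query _ _ => ∅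

/-- The variables of the finalisation protocol `IBFP-M1(h, v)`; `none` is `⊥`. -/
structure FPState (Block : Type*) where
  lockedBlock : Option Block
  acceptedBlock : Option Block
  round : ℕ
  roundAlreadyStarted : Bool
  commitSent : Bool
  finalisedBlockSent : Bool
  roundTimerExpiration : ℕ → Option ℝ

/-- Values of the variables before the initialisation step assigns them. -/
def FPState.blank (Block : Type*) : FPState Block :=
  ⟨none, none, 0, false, false, false, fun _ => none⟩

/-- Status of the finalisation protocol at a node: not running, spawned but not yet initialised,
or initialised. -/
inductive FPStatus (Block : Type*) where
  | stopped
  | spawned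
  | running (p : FPState Block)

/-- Local state of a node. The list `chain` holds the finalised blocks of heights `0, 1, 2, …`;
it is empty before the node is initialised, and afterwards the next height `h_v` is its length.
A running finalisation protocol is always the one of instance `h_v`. `received` is the set of all
received messages. -/
structure NodeState (Node Block Hash Sig : Type*) where
  chain : List (FinalisedBlock Block Sig)
  status : FPStatus Block
  received : Set (Msg Node Block Hash Sig)

/-- Messages sent in one step, with their destinations. -/
abbrev Outbox (Node Block Hash Sig : Type*) := Set (Msg Node Block Hash Sig × Node)

/-- Multicasting a message to a set of nodes. -/
def multicast {Node Block Hash Sig : Type*} (m : Msg Node Block Hash Sig) (V : Set Node) :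
    Outbox Node Block Hash Sig := {x | x.1 = m ∧ x.2 ∈ V}

/-- The blocks inside a chain of finalised blocks. -/
def blocks {Block Sig : Type*} (chain : List (FinalisedBlock Block Sig)) : List Block :=
  chain.map FinalisedBlock.block

/-- The procedure `moveToNewRound`. -/
def FPState.moveToNewRound {Block : Type*} (p : FPState Block) (r : ℕ) : FPState Block :=
  { p with round := r, roundAlreadyStarted := false, acceptedBlock := none }

/-- The commands that an honest node executes. -/
inductive Command (Node : Type*) where
  | ibftInit | igc1
  | fpInit | fpgc1 | fpgc2 | fpgc3 | fpgc4 | fpgc5 | fpgc6 | fpgc7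
  | query
  | reply (h : ℕ) (requester : Node)

namespace Setting

variable {Node Block Tx Hash Sig : Type*} (S : Setting Node Block Tx Hash Sig)

/-- Block validity in IBFT-M1: it includes the check that a finalisation proof can be added. -/
def Valid (B P : Block) : Prop := S.ethValid B P ∧ S.wellFormedToAddFinalProof B

/-- At least a quorum of the seals in the proof are signatures of the block by members of `V`. -/
def ValidFinalisationProof (V : Finset Node) (FB : FinalisedBlock Block Sig) : Prop :=
  quorumOpt V.card ≤
    {cs | cs ∈ FB.proof ∧ ∃ v ∈ V, S.recover (S.keccak FB.block) cs = some v}.ncard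

/-- Validity of a finalised block as the next one after `chain`. -/
def ValidFinalisedBlock (chain : List (FinalisedBlock Block Sig))
    (FB : FinalisedBlock Block Sig) : Prop :=
  S.ValidFinalisationProof (S.validators (blocks chain)) FB ∧
    ∃ P, chain.getLast? = some P ∧ S.Valid FB.block P.block

/-- The procedure `StartNewRound(r, h, v)`, `h` being the length of the chain. A proposer that is
not locked proposes any valid block. -/
def StartNewRound (v : Node) (now : ℝ) (chain : List (FinalisedBlock Block Sig)) (r : ℕ)
    (p p' : FPState Block) (out : Outbox Node Block Hash Sig) : Prop :=
  p' = { p.moveToNewRound r with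
          roundAlreadyStarted := true
          commitSent := false
          finalisedBlockSent := false
          roundTimerExpiration :=
            Function.update p.roundTimerExpiration r (some (now + S.timeoutForRoundZero * 2 ^ r)) } ∧
  ((v ≠ S.proposer (blocks chain) r ∧ out = ∅) ∨
   (v = S.proposer (blocks chain) r ∧ ∃ B,
      (p.lockedBlock = some B ∨
        (p.lockedBlock = none ∧ ∃ P, chain.getLast? = some P ∧ S.Valid B P.block)) ∧
      out = multicast (.signed (.prePrepare chain.length r B) v) (S.validators (blocks chain))))

/-- The procedure `moveToNewRoundAndSendRoundChange(r, h, v)`. -/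
def MoveToNewRoundAndSendRoundChange (v : Node) (chain : List (FinalisedBlock Block Sig)) (r : ℕ)
    (p p' : FPState Block) (out : Outbox Node Block Hash Sig) : Prop :=
  p' = p.moveToNewRound r ∧
  out = multicast (.signed (.roundChange chain.length r) v) (S.validators (blocks chain))

/-- The guarded commands `fpgc_1, …, fpgc_7` of `IBFP-M1(h, v)`, `h` being the length of the chain:
`FPStep v now chain rm c p p' out` says that command `c` leads from `p` to `p'` and sends `out`. -/
inductive FPStep (v : Node) (now : ℝ) (chain : List (FinalisedBlock Block Sig))
    (rm : Set (Msg Node Block Hash Sig)) :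
    Command Node → FPState Block → FPState Block → Outbox Node Block Hash Sig → Prop
  | fpgc1_accept (p : FPState Block) (B : Block) (P : FinalisedBlock Block Sig)
      (accepted_eq : p.acceptedBlock = none)
      (mem : .signed (.prePrepare chain.length p.round B) (S.proposer (blocks chain) p.round) ∈ rm)
      (parent : chain.getLast? = some P)
      (ok : (p.lockedBlock = none ∨ p.lockedBlock = some B) ∧ S.Valid B P.block) :
      FPStep v now chain rm .fpgc1 p { p with acceptedBlock := some B }
        (multicast (.signed (.prepare chain.length p.round (S.keccak B)) v)
          (S.validators (blocks chain)))
  | fpgc1_reject (p p' : FPState Block) (out : Outbox Node Block Hash Sig) (B : Block)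
      (P : FinalisedBlock Block Sig)
      (accepted_eq : p.acceptedBlock = none)
      (mem : .signed (.prePrepare chain.length p.round B) (S.proposer (blocks chain) p.round) ∈ rm)
      (parent : chain.getLast? = some P)
      (not_ok : ¬ ((p.lockedBlock = none ∨ p.lockedBlock = some B) ∧ S.Valid B P.block))
      (move : S.MoveToNewRoundAndSendRoundChange v chain (p.round + 1) p p' out) :
      FPStep v now chain rm .fpgc1 p p' out
  | fpgc2 (p : FPState Block) (B : Block)
      (commitSent_eq : p.commitSent = false)
      (accepted_eq : p.acceptedBlock = some B)
      (quorum : quorumOpt (S.validators (blocks chain)).card ≤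
        {sv | sv ∈ S.validators (blocks chain) ∧
          .signed (.prepare chain.length p.round (S.keccak B)) sv ∈ rm}.ncard) :
      FPStep v now chain rm .fpgc2 p { p with lockedBlock := some B } ∅
  | fpgc3 (p : FPState Block) (B : Block)
      (commitSent_eq : p.commitSent = false)
      (locked_eq : p.lockedBlock = some B)
      (mem : .signed (.prePrepare chain.length p.round B) (S.proposer (blocks chain) p.round) ∈ rm ∨
        ∃ sv ∈ S.validators (blocks chain),
          .signed (.prepare chain.length p.round (S.keccak B)) sv ∈ rm) :
      FPStep v now chain rm .fpgc3 p { p with commitSent := true }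
        (multicast
          (.signed (.commit chain.length p.round (S.keccak B) (S.sign (S.keccak B) v)) v)
          (S.validators (blocks chain)))
  | fpgc4 (p : FPState Block) (B : Block) (CM : Finset (Msg Node Block Hash Sig))
      (finalisationProof : Finset Sig)
      (accepted_eq : p.acceptedBlock = some B)
      (CM_received : ∀ m ∈ CM, m ∈ rm)
      (CM_quorum : quorumOpt (S.validators (blocks chain)).card ≤ CM.card)
      (CM_commit : ∀ m ∈ CM, ∃ cs sv,
        m = .signed (.commit chain.length p.round (S.keccak B) cs) sv ∧
        S.recover (S.keccak B) cs = some sv)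
      (CM_distinct : ∀ c sv c' sv', .signed c sv ∈ CM → .signed c' sv' ∈ CM → c ≠ c' → sv ≠ sv')
      (finalisedBlockSent_eq : p.finalisedBlockSent = false)
      (proof_eq : ∀ cs, cs ∈ finalisationProof ↔
        ∃ h r H sv, .signed (.commit h r H cs) sv ∈ CM) :
      FPStep v now chain rm .fpgc4 p { p with finalisedBlockSent := true, lockedBlock := some B }
        (multicast (.finalisedBlock ⟨B, finalisationProof⟩) Set.univ)
  | fpgc5 (p p' : FPState Block) (out : Outbox Node Block Hash Sig) (r : ℕ)
      (quorum : maxFaulty (S.validators (blocks chain)).card + 1 ≤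
        (({sv | sv ∈ S.validators (blocks chain) ∧
          .signed (.roundChange chain.length r) sv ∈ rm}.ncard : ℕ) : ℤ))
      (later : p.round < r)
      (move : S.MoveToNewRoundAndSendRoundChange v chain r p p' out) :
      FPStep v now chain rm .fpgc5 p p' out
  | fpgc6 (p p' : FPState Block) (out : Outbox Node Block Hash Sig) (e : ℝ)
      (expiration : p.roundTimerExpiration p.round = some e)
      (expired : e ≤ now)
      (move : S.MoveToNewRoundAndSendRoundChange v chain (p.round + 1) p p' out) :
      FPStep v now chain rm .fpgc6 p p' out
  | fpgc7 (p p' : FPState Block) (out : Outbox Node Block Hash Sig) (r : ℕ)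
      (quorum : quorumOpt (S.validators (blocks chain)).card ≤
        {sv | sv ∈ S.validators (blocks chain) ∧
          .signed (.roundChange chain.length r) sv ∈ rm}.ncard)
      (later : p.round < r ∨ (r = p.round ∧ p.roundAlreadyStarted = false))
      (start : S.StartNewRound v now chain r p p' out) :
      FPStep v now chain rm .fpgc7 p p' out

open Classical in
/-- Status of the finalisation protocol right after the chain of `v` has become `chain`: the
instance for the previous height is stopped, and the next one is spawned if `v` is a validator. -/
noncomputable def nextStatus (v : Node) (chain : List (FinalisedBlock Block Sig)) :
    FPStatus Block :=
  if v ∈ S.validators (blocks chain) then .spawned else .stopped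

/-- The steps of an honest node `v` whose clock shows `now`:
`LocalStep v now c s s' out` says that command `c` leads from `s` to `s'` and sends `out`. -/
inductive LocalStep (v : Node) (now : ℝ) : Command Node → NodeState Node Block Hash Sig →
    NodeState Node Block Hash Sig → Outbox Node Block Hash Sig → Prop
  | ibftInit (s : NodeState Node Block Hash Sig) (not_initialised : s.chain = []) :
      LocalStep v now .ibftInit s
        { s with chain := [⟨S.genesis, ∅⟩], status := S.nextStatus v [⟨S.genesis, ∅⟩] } ∅
  | igc1 (s : NodeState Node Block Hash Sig) (FB : FinalisedBlock Block Sig)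
      (initialised : s.chain ≠ [])
      (mem : .finalisedBlock FB ∈ s.received)
      (height_eq : S.height FB.block = s.chain.length)
      (valid : S.ValidFinalisedBlock s.chain FB) :
      LocalStep v now .igc1 s
        { s with chain := s.chain ++ [FB], status := S.nextStatus v (s.chain ++ [FB]) } ∅
  | fpInit (s : NodeState Node Block Hash Sig) (p : FPState Block)
      (out : Outbox Node Block Hash Sig)
      (status_eq : s.status = .spawned)
      (start : S.StartNewRound v now s.chain 0 (FPState.blank Block) p out) :
      LocalStep v now .fpInit s { s with status := .running p } out
  | fp (c : Command Node) (s : NodeState Node Block Hash Sig) (p p' : FPState Block)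
      (out : Outbox Node Block Hash Sig)
      (status_eq : s.status = .running p)
      (step : S.FPStep v now s.chain s.received c p p' out) :
      LocalStep v now c s { s with status := .running p' } out
  | query (s : NodeState Node Block Hash Sig) (initialised : s.chain ≠ []) :
      LocalStep v now .query s s (multicast (.query s.chain.length v) Set.univ)
  | reply (s : NodeState Node Block Hash Sig) (h : ℕ) (u : Node) (FB : FinalisedBlock Block Sig)
      (mem : .query h u ∈ s.received)
      (available : s.chain[h]? = some FB) :
      LocalStep v now (.reply h u) s s (multicast (.finalisedBlock FB) {u})

end Setting

/-- A message in the network: its destination and the time at which it was sent. -/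
structure Packet (Node Block Hash Sig : Type*) where
  msg : Msg Node Block Hash Sig
  dest : Node
  time : ℝ

/-- Global configuration: the local states, and all the messages sent so far. -/
structure Config (Node Block Hash Sig : Type*) where
  node : Node → NodeState Node Block Hash Sig
  sent : Set (Packet Node Block Hash Sig)

/-- The initial configuration. -/
def Config.initial (Node Block Hash Sig : Type*) : Config Node Block Hash Sig :=
  ⟨fun _ => ⟨[], .stopped, ∅⟩, ∅⟩

/-- The message has been sent by some node. -/
def Config.Sent {Node Block Hash Sig : Type*} (σ : Config Node Block Hash Sig)
    (m : Msg Node Block Hash Sig) : Prop :=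
  ∃ p ∈ σ.sent, p.msg = m

open Classical in
/-- Result of a step of `v` at time `t` with new local state `s` and messages `out`. -/
noncomputable def Config.update {Node Block Hash Sig : Type*} (σ : Config Node Block Hash Sig)
    (v : Node) (t : ℝ) (s : NodeState Node Block Hash Sig) (out : Outbox Node Block Hash Sig) :
    Config Node Block Hash Sig :=
  { node := Function.update σ.node v s
    sent := σ.sent ∪ {p | (p.msg, p.dest) ∈ out ∧ p.time = t} }

/-- Result of delivering a set of packets. -/
def Config.deliver {Node Block Hash Sig : Type*} (σ : Config Node Block Hash Sig)
    (D : Set (Packet Node Block Hash Sig)) : Config Node Block Hash Sig :=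
  { node := fun u =>
      { σ.node u with received := (σ.node u).received ∪ {m | ∃ p ∈ D, p.dest = u ∧ p.msg = m} }
    sent := σ.sent }

/-- What happens in one step of the system. -/
inductive Action (Node Block Hash Sig : Type*) where
  | command (v : Node) (c : Command Node)
  | deliver (D : Set (Packet Node Block Hash Sig))
  | byzantine (b : Node) (p : Packet Node Block Hash Sig)
  | idle

namespace Setting

variable {Node Block Tx Hash Sig : Type*} (S : Setting Node Block Tx Hash Sig)

/-- What colluding Byzantine nodes are able to send, having seen everything sent so far: they can
forge neither a message signature nor a commit seal of an honest node, and nothing else limits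
them. -/
def CanForge (byz : Set Node) (σ : Config Node Block Hash Sig)
    (m : Msg Node Block Hash Sig) : Prop :=
  (∀ c v, m = .signed c v → v ∈ byz ∨ σ.Sent m) ∧
  (∀ H v, v ∉ byz → S.sign H v ∈ m.seals → ∃ m', σ.Sent m' ∧ S.sign H v ∈ m'.seals)

/-- One step of the system at real time `t`, the local clocks showing `now`: an honest node
executes a command, messages are delivered, or a Byzantine node sends a message. -/
inductive Step (byz : Set Node) (t : ℝ) (now : Node → ℝ) : Action Node Block Hash Sig →
    Config Node Block Hash Sig → Config Node Block Hash Sig → Prop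
  | command (σ : Config Node Block Hash Sig) (v : Node) (c : Command Node)
      (s : NodeState Node Block Hash Sig) (out : Outbox Node Block Hash Sig)
      (honest : v ∉ byz)
      (step : S.LocalStep v (now v) c (σ.node v) s out) :
      Step byz t now (.command v c) σ (σ.update v t s out)
  | deliver (σ : Config Node Block Hash Sig) (D : Set (Packet Node Block Hash Sig))
      (sub : D ⊆ σ.sent) :
      Step byz t now (.deliver D) σ (σ.deliver D)
  | byzantine (σ : Config Node Block Hash Sig) (b : Node) (p : Packet Node Block Hash Sig)
      (mem : b ∈ byz)
      (time_eq : p.time = t)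
      (forge : S.CanForge byz σ p.msg) :
      Step byz t now (.byzantine b p) σ { σ with sent := insert p σ.sent }
  | idle (σ : Config Node Block Hash Sig) :
      Step byz t now .idle σ σ

/-- A run of the system with set `byz` of Byzantine nodes. Message delivery is unconstrained here:
messages may be delayed arbitrarily or lost. -/
structure Run (byz : Set Node) where
  cfg : ℕ → Config Node Block Hash Sig
  act : ℕ → Action Node Block Hash Sig
  /-- real time of each step -/
  time : ℕ → ℝ
  /-- reading of the local clock of each node, as a function of real time -/
  clock : Node → ℝ → ℝ
  time_mono : Monotone time
  time_unbounded : Tendsto time atTop atTop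
  clock_mono : ∀ v, Monotone (clock v)
  cfg_zero : cfg 0 = Config.initial Node Block Hash Sig
  step : ∀ n, S.Step byz (time n) (fun v => clock v (time n)) (act n) (cfg n) (cfg (n + 1))

/-- Number of Byzantine nodes in a validator set. -/
noncomputable def byzCount (byz : Set Node) (V : Finset Node) : ℤ :=
  (({v | v ∈ V ∧ v ∈ byz}.ncard : ℕ) : ℤ)

/-- All honest validators of instance `h` agree that the validator set of instance `h` is `V`. -/
def Run.AgreeOnValidators {S : Setting Node Block Tx Hash Sig} {byz : Set Node} (ρ : S.Run byz)
    (h : ℕ) (V : Finset Node) : Prop :=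
  ∀ n, ∀ v ∉ byz, h ≤ ((ρ.cfg n).node v).chain.length →
    v ∈ S.validators (blocks (((ρ.cfg n).node v).chain.take h)) →
    S.validators (blocks (((ρ.cfg n).node v).chain.take h)) = V

/-- `FB` has been produced (sent as a finalised block by a node, honest or Byzantine) out of
instance `h`: at least a quorum of validators have in `FB` a commit seal of its block that they
sent in a Commit message of instance `h`. -/
def ProducedByInstance (σ : Config Node Block Hash Sig) (h : ℕ) (V : Finset Node)
    (FB : FinalisedBlock Block Sig) : Prop :=
  σ.Sent (.finalisedBlock FB) ∧
  quorumOpt V.card ≤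
    {sv | sv ∈ V ∧ ∃ cs ∈ FB.proof, S.recover (S.keccak FB.block) cs = some sv ∧
      ∃ r, σ.Sent (.signed (.commit h r (S.keccak FB.block) cs) sv)}.ncard

/-- `t`-Byzantine-fault-tolerant safety of instance `h` of the finalisation protocol, `t` being a
function of the number of validators:
(1) what the instance produces is a valid finalised block for height `h`;
(2) no two finalised blocks for height `h` with valid finalisation proofs but different blocks are
ever produced by any node. -/
def TolerantSafety (t : ℕ → ℤ) (h : ℕ) : Prop :=
  ∀ (byz : Set Node) (ρ : S.Run byz) (V : Finset Node),
    ρ.AgreeOnValidators h V → byzCount byz V ≤ t V.card →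
    ∀ n,
      (∀ FB, S.ProducedByInstance (ρ.cfg n) h V FB →
        S.height FB.block = h ∧
        ∃ v ∉ byz, h ≤ ((ρ.cfg n).node v).chain.length ∧
          S.ValidFinalisedBlock (((ρ.cfg n).node v).chain.take h) FB) ∧
      (∀ FB FB', (ρ.cfg n).Sent (.finalisedBlock FB) → (ρ.cfg n).Sent (.finalisedBlock FB') →
        S.height FB.block = h → S.height FB'.block = h →
        S.ValidFinalisationProof V FB → S.ValidFinalisationProof V FB' →
        FB.block = FB'.block)

/-- Optimal safety threshold of instance `h`. -/
def OptimalSafetyThreshold (h : ℕ) : Prop := S.TolerantSafety maxFaulty h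

/-- Optimal persistence threshold: all instances have the optimal safety threshold. -/
def OptimalPersistenceThreshold : Prop := ∀ h, 1 ≤ h → S.OptimalSafetyThreshold h

/-- Transaction `T` is at position `(h, k)` of the local ledger of `v`: it is the `k`-th transaction
of the block of height `h` of the local chain. -/
def TxAt (σ : Config Node Block Hash Sig) (v : Node) (h k : ℕ) (T : Tx) : Prop :=
  ∃ FB, (σ.node v).chain[h]? = some FB ∧ (S.txs FB.block)[k]? = some T

/-- For every instance that an honest node reaches, at most `t(n)` of its `n` validators are
Byzantine. -/
def Run.FaultBound {S : Setting Node Block Tx Hash Sig} {byz : Set Node} (ρ : S.Run byz)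
    (t : ℕ → ℤ) : Prop :=
  ∀ n, ∀ v ∉ byz, ∀ h, 1 ≤ h → h ≤ ((ρ.cfg n).node v).chain.length →
    byzCount byz (S.validators (blocks (((ρ.cfg n).node v).chain.take h))) ≤
      t (S.validators (blocks (((ρ.cfg n).node v).chain.take h))).card

/-- Eventual synchrony: from some time `GST` on, every message sent to an honest node is delivered
within some bound `Δ`. Messages sent before `GST` may be lost. -/
def Run.EventuallySynchronous {S : Setting Node Block Tx Hash Sig} {byz : Set Node}
    (ρ : S.Run byz) : Prop :=
  ∃ GST Δ : ℝ, 0 < Δ ∧ ∀ n, ∀ p ∈ (ρ.cfg n).sent, GST ≤ p.time → p.dest ∉ byz →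
    ∃ m D, ρ.act m = .deliver D ∧ p ∈ D ∧ ρ.time m ≤ p.time + Δ

/-- Honest nodes do not halt: they eventually start, they eventually add a valid finalised block
for the next height if they keep having one available, they query the other nodes for the next
finalised block again and again, and they answer the queries they receive for a finalised block
that they have. -/
structure Run.HonestNodesLive {S : Setting Node Block Tx Hash Sig} {byz : Set Node}
    (ρ : S.Run byz) : Prop where
  starts : ∀ v ∉ byz, ∃ n, ρ.act n = .command v .ibftInit
  adds : ∀ v ∉ byz, ∀ n,
    (∀ m, n ≤ m → ∃ s out,
      S.LocalStep v (ρ.clock v (ρ.time m)) .igc1 ((ρ.cfg m).node v) s out) →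
    ∃ m, n ≤ m ∧ ρ.act m = .command v .igc1
  queries : ∀ v ∉ byz, ∀ n, ∃ m, n ≤ m ∧ ρ.act m = .command v .query
  replies : ∀ v ∉ byz, ∀ n D p h u, ρ.act n = .deliver D → p ∈ D → p.dest = v →
    p.msg = .query h u → h < ((ρ.cfg n).node v).chain.length →
    ∃ m, n < m ∧ ρ.act m = .command v (.reply h u)

/-- `t`-Byzantine-fault-tolerant persistence, `t` being a function of the number of validators: if
an honest node has transaction `T` at some position of its ledger, then
(i) no honest node ever has another transaction at that position;
(ii) in an eventually synchronous network, every honest node eventually has `T` there. -/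
def TolerantPersistence (t : ℕ → ℤ) : Prop :=
  ∀ (byz : Set Node) (ρ : S.Run byz), ρ.FaultBound t →
    ∀ n, ∀ v ∉ byz, ∀ h k T, S.TxAt (ρ.cfg n) v h k T →
      (∀ n', ∀ v' ∉ byz, ∀ T', S.TxAt (ρ.cfg n') v' h k T' → T' = T) ∧
      (ρ.EventuallySynchronous → ρ.HonestNodesLive →
        ∀ v' ∉ byz, ∃ n', S.TxAt (ρ.cfg n') v' h k T)

end Setting

end IBFT

/-!
# Safety and persistence of IBFT-M1

The protocol is safe because a lock is never released. An honest validator puts its commit seal only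
on the block on which it is locked, and it locks only on its accepted block, which it accepts only
while unlocked or locked on that very block. Hence its lock, once set, never changes within an
instance, and, as an instance runs at exactly one chain length, an honest validator seals at most
one block of each height, whatever the rounds are. Seals of honest nodes cannot be forged, so two
finalised blocks of the same height, each with a quorum of seals, share an honest signer
(`exists_honest_of_quorums`) and are equal. These facts are packaged in the invariant `Invariant` of
reachable configurations, which records in `Backed` what a seal of an honest node says about its
signer.

Given safety, the chains of honest nodes agree by induction on the height (`Run.blocks_agree`): equal
blocks below height `h` determine equal validator sets of instance `h`. For liveness, a node whose
chain stops growing forever at a height that another honest node has passed would query that node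
after the global stabilisation time, be answered with the missing finalised block, find it valid
because the chains agree, and be able to append it forever after (`Run.exists_length_gt`).
-/

namespace IBFT

/-! ### Quorums -/

/-- Two quorums overlap in at least `n / 3` validators, which is more than the `f(n)` that can be
Byzantine. -/
theorem exists_honest_of_quorums {Node : Type*} {byz : Set Node} {V : Finset Node}
    (hbyz : Setting.byzCount byz V ≤ maxFaulty V.card) {A A' : Set Node}
    (hA : A ⊆ V) (hA' : A' ⊆ V)
    (hQ : quorumOpt V.card ≤ A.ncard) (hQ' : quorumOpt V.card ≤ A'.ncard) :
    ∃ v ∈ A, v ∈ A' ∧ v ∉ byz := by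
  by_contra! hcon
  have hV : (V : Set Node).Finite := V.finite_toSet
  have hunion : (A ∪ A').ncard ≤ V.card := by
    simpa using Set.ncard_le_ncard (Set.union_subset hA hA') hV
  have hinter : (A ∩ A').ncard ≤ {v | v ∈ V ∧ v ∈ byz}.ncard :=
    Set.ncard_le_ncard (fun v hv => ⟨by exact_mod_cast hA hv.1, hcon v hv.1 hv.2⟩)
      (hV.subset fun v hv => hv.1)
  have hsum := Set.ncard_union_add_ncard_inter A A' (hV.subset hA) (hV.subset hA')
  have hQcard : 2 * V.card ≤ 3 * quorumOpt V.card := by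
    have h := Nat.le_ceil ((2 * (V.card : ℚ)) / 3)
    have h' : (2 * (V.card : ℚ)) ≤ 3 * (quorumOpt V.card : ℚ) := by
      unfold quorumOpt
      linarith
    exact_mod_cast h'
  have hf : 3 * maxFaulty V.card ≤ (V.card : ℤ) - 1 := by
    have h := Int.floor_le (((V.card : ℚ) - 1) / 3)
    have h' : 3 * (maxFaulty V.card : ℚ) ≤ (V.card : ℚ) - 1 := by
      unfold maxFaulty
      linarith
    exact_mod_cast h'
  unfold Setting.byzCount at hbyz
  omega

namespace Setting

variable {Node Block Tx Hash Sig : Type*} {S : Setting Node Block Tx Hash Sig}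

/-! ### Signatures and finalisation proofs -/

theorem recover_sign (H : Hash) (v : Node) : S.recover H (S.sign H v) = some v :=
  (S.recover_eq_some_iff _ _ _).2 rfl

theorem sign_injective (H : Hash) : Function.Injective (S.sign H) := fun v w h => by
  have h' := S.recover_sign H v
  rw [h, recover_sign] at h'
  exact (Option.some.inj h').symm

theorem sign_eq_sign_iff {H H' : Hash} {v v' : Node} :
    S.sign H v = S.sign H' v' ↔ H = H' ∧ v = v' := by
  constructor
  · intro h
    obtain rfl := S.sign_unique _ _ _ _ h
    exact ⟨rfl, sign_injective _ h⟩
  · rintro ⟨rfl, rfl⟩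
    rfl

/-- Seals of a block correspond to their signers, so the proof is valid exactly when a quorum of
members of `V` have signed. -/
theorem validFinalisationProof_iff {V : Finset Node} {FB : FinalisedBlock Block Sig} :
    S.ValidFinalisationProof V FB ↔
      quorumOpt V.card ≤ {v | v ∈ V ∧ S.sign (S.keccak FB.block) v ∈ FB.proof}.ncard := by
  have h : {cs | cs ∈ FB.proof ∧ ∃ v ∈ V, S.recover (S.keccak FB.block) cs = some v} =
      S.sign (S.keccak FB.block) '' {v | v ∈ V ∧ S.sign (S.keccak FB.block) v ∈ FB.proof} := by
    ext cs
    simp only [S.recover_eq_some_iff, Set.mem_ofPred_eq, Set.mem_image]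
    constructor
    · rintro ⟨hcs, v, hv, rfl⟩
      exact ⟨v, ⟨hv, hcs⟩, rfl⟩
    · rintro ⟨v, ⟨hv, hcs⟩, rfl⟩
      exact ⟨hcs, v, hv, rfl⟩
  rw [ValidFinalisationProof, h, Set.ncard_image_of_injective _ (sign_injective _)]

/-- Only the blocks of a chain matter for the validity of the next finalised block. -/
theorem ValidFinalisedBlock.congr_blocks {c c' : List (FinalisedBlock Block Sig)}
    (h : blocks c = blocks c') {FB : FinalisedBlock Block Sig}
    (hFB : S.ValidFinalisedBlock c FB) : S.ValidFinalisedBlock c' FB := by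
  obtain ⟨hp, P, hP, hv⟩ := hFB
  refine ⟨h ▸ hp, ?_⟩
  have hlast : (c'.getLast?).map FinalisedBlock.block = some P.block := by
    rw [← List.getLast?_map, ← blocks, ← h, blocks, List.getLast?_map, hP, Option.map_some]
  obtain ⟨P', hP', hb⟩ := Option.map_eq_some_iff.1 hlast
  exact ⟨P', hP', hb ▸ hv⟩

/-! ### Invariants of an honest node -/

/-- `B` is a valid block after the last block of `chain`. -/
def ValidNext (S : Setting Node Block Tx Hash Sig) (chain : List (FinalisedBlock Block Sig))
    (B : Block) : Prop :=
  ∃ P, chain.getLast? = some P ∧ S.Valid B P.block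

/-- Invariant of a running instance of the finalisation protocol. The last field is what makes locks
permanent: as a node locks on its accepted block only, it can only relock on the same block. -/
structure WellFormedFP (S : Setting Node Block Tx Hash Sig)
    (chain : List (FinalisedBlock Block Sig)) (p : FPState Block) : Prop where
  accepted : ∀ B, p.acceptedBlock = some B → S.ValidNext chain B
  locked : ∀ B, p.lockedBlock = some B → S.ValidNext chain B
  eq : ∀ B B', p.acceptedBlock = some B → p.lockedBlock = some B' → B = B'

/-- Invariant of the local state of an honest node. -/
structure WellFormed (S : Setting Node Block Tx Hash Sig) (v : Node)
    (s : NodeState Node Block Hash Sig) : Prop where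
  head : ∀ FB, s.chain[0]? = some FB → FB = ⟨S.genesis, ∅⟩
  height : ∀ i FB, s.chain[i]? = some FB → S.height FB.block = i
  received : ∀ i FB, 1 ≤ i → s.chain[i]? = some FB → .finalisedBlock FB ∈ s.received
  valid : ∀ i FB, 1 ≤ i → s.chain[i]? = some FB → S.ValidFinalisedBlock (s.chain.take i) FB
  validator : s.status ≠ .stopped → v ∈ S.validators (blocks s.chain)
  running : ∀ p, s.status = .running p → S.WellFormedFP s.chain p

theorem nextStatus_ne_stopped {v : Node} {chain : List (FinalisedBlock Block Sig)}
    (h : S.nextStatus v chain ≠ .stopped) : v ∈ S.validators (blocks chain) := by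
  unfold nextStatus at h
  split_ifs at h with hv
  · exact hv
  · exact absurd rfl h

theorem nextStatus_ne_running {v : Node} {chain : List (FinalisedBlock Block Sig)}
    {p : FPState Block} : S.nextStatus v chain ≠ .running p := by
  unfold nextStatus
  split_ifs <;> simp

/-- Validity of the next block fixes its height. -/
theorem WellFormed.height_of_validNext {v : Node} {s : NodeState Node Block Hash Sig}
    (hs : S.WellFormed v s) {B : Block} (hB : S.ValidNext s.chain B) :
    S.height B = s.chain.length := by
  obtain ⟨P, hP, hv⟩ := hB
  have h1 : s.chain ≠ [] := by
    rintro h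
    simp [h] at hP
  have h2 : 0 < s.chain.length := List.length_pos_of_ne_nil h1
  rw [List.getLast?_eq_getElem?] at hP
  have h3 := hs.height _ _ hP
  have h4 := S.height_of_ethValid _ _ hv.1
  omega

theorem WellFormedFP.moveToNewRound {chain : List (FinalisedBlock Block Sig)} {p : FPState Block}
    (hp : S.WellFormedFP chain p) (r : ℕ) : S.WellFormedFP chain (p.moveToNewRound r) :=
  ⟨by simp [FPState.moveToNewRound], hp.locked, by simp [FPState.moveToNewRound]⟩

theorem StartNewRound.wellFormedFP {v : Node} {now : ℝ} {chain : List (FinalisedBlock Block Sig)}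
    {r : ℕ} {p p' : FPState Block} {out : Outbox Node Block Hash Sig}
    (h : S.StartNewRound v now chain r p p' out) (hp : S.WellFormedFP chain p) :
    S.WellFormedFP chain p' := by
  obtain ⟨rfl, -⟩ := h
  exact ⟨by simp [FPState.moveToNewRound], hp.locked, by simp [FPState.moveToNewRound]⟩

theorem FPStep.wellFormedFP {v : Node} {now : ℝ} {chain : List (FinalisedBlock Block Sig)}
    {rm : Set (Msg Node Block Hash Sig)} {c : Command Node} {p p' : FPState Block}
    {out : Outbox Node Block Hash Sig} (h : S.FPStep v now chain rm c p p' out)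
    (hp : S.WellFormedFP chain p) : S.WellFormedFP chain p' := by
  cases h with
  | fpgc1_accept _ B P _ _ parent ok =>
    obtain ⟨hl, hv⟩ := ok
    refine ⟨?_, hp.locked, ?_⟩
    · intro B' hB'
      obtain rfl : B = B' := Option.some.inj hB'
      exact ⟨P, parent, hv⟩
    · rintro _ B' ⟨⟩ hB'
      have hB'' : p.lockedBlock = some B' := hB'
      rcases hl with hl | hl <;> rw [hl] at hB''
      · cases hB''
      · exact Option.some.inj hB''
  | fpgc2 _ B _ accepted_eq _ =>
    refine ⟨hp.accepted, ?_, ?_⟩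
    · rintro _ ⟨⟩
      exact hp.accepted _ accepted_eq
    · rintro B' _ hB' ⟨⟩
      exact Option.some.inj (hB'.symm.trans accepted_eq)
  | fpgc3 => exact ⟨hp.accepted, hp.locked, hp.eq⟩
  | fpgc4 _ B _ _ accepted_eq =>
    refine ⟨hp.accepted, ?_, ?_⟩
    · rintro _ ⟨⟩
      exact hp.accepted _ accepted_eq
    · rintro B' _ hB' ⟨⟩
      exact Option.some.inj (hB'.symm.trans accepted_eq)
  | fpgc1_reject _ _ _ _ _ _ _ _ _ move => exact move.1 ▸ hp.moveToNewRound _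
  | fpgc5 _ _ _ _ _ _ move => exact move.1 ▸ hp.moveToNewRound _
  | fpgc6 _ _ _ _ _ _ move => exact move.1 ▸ hp.moveToNewRound _
  | fpgc7 _ _ _ _ _ _ start => exact start.wellFormedFP hp

/-- A lock is permanent while the instance runs. -/
theorem FPStep.lockedBlock_eq {v : Node} {now : ℝ} {chain : List (FinalisedBlock Block Sig)}
    {rm : Set (Msg Node Block Hash Sig)} {c : Command Node} {p p' : FPState Block}
    {out : Outbox Node Block Hash Sig} (h : S.FPStep v now chain rm c p p' out)
    (hp : S.WellFormedFP chain p) {B : Block} (hB : p.lockedBlock = some B) :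
    p'.lockedBlock = some B := by
  cases h with
  | fpgc1_accept => exact hB
  | fpgc2 _ B' _ accepted_eq _ => exact congrArg some (hp.eq _ _ accepted_eq hB)
  | fpgc3 => exact hB
  | fpgc4 _ B' _ _ accepted_eq => exact congrArg some (hp.eq _ _ accepted_eq hB)
  | fpgc1_reject _ _ _ _ _ _ _ _ _ move => exact move.1 ▸ hB
  | fpgc5 _ _ _ _ _ _ move => exact move.1 ▸ hB
  | fpgc6 _ _ _ _ _ _ move => exact move.1 ▸ hB
  | fpgc7 _ _ _ _ _ _ start => exact start.1 ▸ hB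

theorem LocalStep.received_eq {v : Node} {now : ℝ} {c : Command Node}
    {s s' : NodeState Node Block Hash Sig} {out : Outbox Node Block Hash Sig}
    (h : S.LocalStep v now c s s' out) : s'.received = s.received := by
  cases h <;> rfl

theorem LocalStep.chain_prefix {v : Node} {now : ℝ} {c : Command Node}
    {s s' : NodeState Node Block Hash Sig} {out : Outbox Node Block Hash Sig}
    (h : S.LocalStep v now c s s' out) : s.chain <+: s'.chain := by
  cases h with
  | ibftInit _ h => simp [h]
  | igc1 => exact List.prefix_append _ _
  | _ => exact List.prefix_rfl

/-- While the chain stays the same, a lock stays in place. -/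
theorem LocalStep.locked {v : Node} {now : ℝ} {c : Command Node}
    {s s' : NodeState Node Block Hash Sig} {out : Outbox Node Block Hash Sig}
    (h : S.LocalStep v now c s s' out) (hs : S.WellFormed v s)
    (hlen : s.chain.length = s'.chain.length) {p : FPState Block} {B : Block}
    (hp : s.status = .running p) (hB : p.lockedBlock = some B) :
    ∃ p', s'.status = .running p' ∧ p'.lockedBlock = some B := by
  cases h with
  | ibftInit _ h => simp [h] at hlen
  | igc1 => simp at hlen
  | fpInit _ _ _ status_eq _ => simp [hp] at status_eq
  | fp _ _ q q' _ status_eq step =>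
    obtain rfl : p = q := by simpa using hp.symm.trans status_eq
    exact ⟨q', rfl, step.lockedBlock_eq (hs.running _ hp) hB⟩
  | query => exact ⟨p, hp, hB⟩
  | reply => exact ⟨p, hp, hB⟩

theorem LocalStep.wellFormed {v : Node} {now : ℝ} {c : Command Node}
    {s s' : NodeState Node Block Hash Sig} {out : Outbox Node Block Hash Sig}
    (h : S.LocalStep v now c s s' out) (hs : S.WellFormed v s) : S.WellFormed v s' := by
  cases h with
  | ibftInit _ h =>
    have hone : ∀ (i : ℕ) (FB G : FinalisedBlock Block Sig), [G][i]? = some FB → i = 0 ∧ FB = G := by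
      intro i FB G hi
      rcases i with _ | i
      · simpa using hi.symm
      · simp at hi
    refine ⟨fun FB hFB => (hone _ _ _ hFB).2, fun i FB hFB => ?_, fun i FB hi hFB => ?_,
      fun i FB hi hFB => ?_, nextStatus_ne_stopped, fun p hp => (nextStatus_ne_running hp).elim⟩
    · obtain ⟨rfl, rfl⟩ := hone _ _ _ hFB
      exact S.height_genesis
    · have := (hone _ _ _ hFB).1
      omega
    · have := (hone _ _ _ hFB).1
      omega
  | igc1 _ FB initialised mem height_eq valid =>
    have hpos : 0 < s.chain.length := List.length_pos_of_ne_nil initialised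
    have hcases : ∀ (i : ℕ) (F : FinalisedBlock Block Sig), (s.chain ++ [FB])[i]? = some F →
        (i < s.chain.length ∧ s.chain[i]? = some F) ∨ (i = s.chain.length ∧ F = FB) := by
      intro i F hi
      rcases lt_trichotomy i s.chain.length with hlt | heq | hgt
      · rw [List.getElem?_append_left hlt] at hi
        exact Or.inl ⟨hlt, hi⟩
      · subst heq
        simp at hi
        exact Or.inr ⟨rfl, hi.symm⟩
      · rw [List.getElem?_eq_none (by simpa using hgt)] at hi
        cases hi
    refine ⟨fun F hF => ?_, fun i F hF => ?_, fun i F hi hF => ?_, fun i F hi hF => ?_,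
      nextStatus_ne_stopped, fun p hp => (nextStatus_ne_running hp).elim⟩
    · rcases hcases _ _ hF with ⟨_, h⟩ | ⟨h, _⟩
      · exact hs.head _ h
      · omega
    · rcases hcases _ _ hF with ⟨_, h⟩ | ⟨rfl, rfl⟩
      · exact hs.height _ _ h
      · exact height_eq
    · rcases hcases _ _ hF with ⟨_, h⟩ | ⟨rfl, rfl⟩
      · exact hs.received _ _ hi h
      · exact mem
    · rcases hcases _ _ hF with ⟨hlt, h⟩ | ⟨rfl, rfl⟩
      · change S.ValidFinalisedBlock ((s.chain ++ [FB]).take i) F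
        rw [List.take_append_of_le_length hlt.le]
        exact hs.valid _ _ hi h
      · simpa using valid
  | fpInit _ p out status_eq start =>
    refine ⟨hs.head, hs.height, hs.received, hs.valid,
      fun _ => hs.validator (by simp [status_eq]), ?_⟩
    rintro _ ⟨⟩
    exact start.wellFormedFP ⟨by simp [FPState.blank], by simp [FPState.blank],
      by simp [FPState.blank]⟩
  | fp _ _ p p' _ status_eq step =>
    refine ⟨hs.head, hs.height, hs.received, hs.valid,
      fun _ => hs.validator (by simp [status_eq]), ?_⟩
    rintro _ ⟨⟩
    exact step.wellFormedFP (hs.running _ status_eq)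
  | query => exact hs
  | reply => exact hs

/-! ### Messages sent by an honest node -/

/-- What an honest node `v` in state `s` may send: messages signed by itself, Commit messages for the
block on which it is locked, and finalised blocks whose seals it has received. -/
structure Sendable (S : Setting Node Block Tx Hash Sig) (v : Node)
    (s : NodeState Node Block Hash Sig) (m : Msg Node Block Hash Sig) : Prop where
  signer : ∀ c u, m = .signed c u → u = v
  commit : ∀ h r H cs u, m = .signed (.commit h r H cs) u → ∃ p B, s.status = .running p ∧
    p.lockedBlock = some B ∧ h = s.chain.length ∧ H = S.keccak B ∧ cs = S.sign H v
  proof : ∀ FB cs, m = .finalisedBlock FB → cs ∈ FB.proof → ∃ m' ∈ s.received, cs ∈ m'.seals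

theorem StartNewRound.sendable {v : Node} {now : ℝ} {chain : List (FinalisedBlock Block Sig)}
    {r : ℕ} {p p' : FPState Block} {out : Outbox Node Block Hash Sig}
    (h : S.StartNewRound v now chain r p p' out) (s : NodeState Node Block Hash Sig)
    {m : Msg Node Block Hash Sig} {d : Node} (hm : (m, d) ∈ out) : S.Sendable v s m := by
  rcases h.2 with ⟨-, rfl⟩ | ⟨-, B, -, rfl⟩
  · exact absurd hm (Set.notMem_empty _)
  · obtain ⟨rfl, -⟩ := hm
    constructor <;> simp

theorem MoveToNewRoundAndSendRoundChange.sendable {v : Node}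
    {chain : List (FinalisedBlock Block Sig)} {r : ℕ} {p p' : FPState Block}
    {out : Outbox Node Block Hash Sig}
    (h : S.MoveToNewRoundAndSendRoundChange v chain r p p' out) (s : NodeState Node Block Hash Sig)
    {m : Msg Node Block Hash Sig} {d : Node} (hm : (m, d) ∈ out) : S.Sendable v s m := by
  obtain ⟨-, rfl⟩ := h
  obtain ⟨rfl, -⟩ := hm
  constructor <;> simp

theorem LocalStep.sendable {v : Node} {now : ℝ} {c : Command Node}
    {s s' : NodeState Node Block Hash Sig} {out : Outbox Node Block Hash Sig}
    (h : S.LocalStep v now c s s' out) (hs : S.WellFormed v s)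
    {m : Msg Node Block Hash Sig} {d : Node} (hm : (m, d) ∈ out) : S.Sendable v s m := by
  cases h with
  | ibftInit => exact absurd hm (Set.notMem_empty _)
  | igc1 => exact absurd hm (Set.notMem_empty _)
  | fpInit _ _ _ _ start => exact start.sendable s hm
  | fp _ _ p p' _ status_eq step =>
    cases step with
    | fpgc1_accept =>
      obtain ⟨rfl, -⟩ := hm
      constructor <;> simp
    | fpgc2 => exact absurd hm (Set.notMem_empty _)
    | fpgc3 _ B _ locked_eq _ =>
      obtain ⟨rfl, -⟩ := hm
      refine ⟨by simp, ?_, by simp⟩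
      rintro _ _ _ _ _ ⟨⟩
      exact ⟨p, B, status_eq, locked_eq, rfl, rfl, rfl⟩
    | fpgc4 _ B CM fp _ CM_received _ _ _ _ proof_eq =>
      obtain ⟨rfl, -⟩ := hm
      refine ⟨by simp, by simp, ?_⟩
      rintro _ cs ⟨⟩ hcs
      obtain ⟨h, r, H, sv, hm'⟩ := (proof_eq cs).1 hcs
      exact ⟨_, CM_received _ hm', rfl⟩
    | fpgc1_reject _ _ _ _ _ _ _ _ _ move => exact move.sendable s hm
    | fpgc5 _ _ _ _ _ _ move => exact move.sendable s hm
    | fpgc6 _ _ _ _ _ _ move => exact move.sendable s hm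
    | fpgc7 _ _ _ _ _ _ start => exact start.sendable s hm
  | query =>
    obtain ⟨rfl, -⟩ := hm
    constructor <;> simp
  | reply _ h u FB mem available =>
    obtain ⟨rfl, -⟩ := hm
    refine ⟨by simp, by simp, ?_⟩
    rintro _ cs ⟨⟩ hcs
    -- The genesis block carries no seals; any later block of the chain has been received.
    rcases Nat.eq_zero_or_pos h with rfl | hpos
    · rw [hs.head _ available] at hcs
      simp at hcs
    · exact ⟨_, hs.received _ _ hpos available, hcs⟩

/-! ### Invariants of the system -/

/-- What a seal of `B` by an honest node with local state `s` entails: the node has reached the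
instance of the height of `B`, is a validator of it, `B` is valid there, and the node is locked on
`B` for as long as that instance lasts. -/
structure Backed (S : Setting Node Block Tx Hash Sig) (v : Node)
    (s : NodeState Node Block Hash Sig) (B : Block) : Prop where
  le : S.height B ≤ s.chain.length
  validator : v ∈ S.validators (blocks (s.chain.take (S.height B)))
  validNext : S.ValidNext (s.chain.take (S.height B)) B
  locked : S.height B = s.chain.length → ∃ p, s.status = .running p ∧ p.lockedBlock = some B

theorem Backed.of_locked {v : Node} {s : NodeState Node Block Hash Sig} {p : FPState Block}
    {B : Block} (hs : S.WellFormed v s) (hp : s.status = .running p)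
    (hB : p.lockedBlock = some B) : S.Backed v s B := by
  have hv := (hs.running _ hp).locked _ hB
  have hh := hs.height_of_validNext hv
  refine ⟨hh.le, ?_, ?_, fun _ => ⟨p, hp, hB⟩⟩
  · rw [hh, List.take_length]
    exact hs.validator (by simp [hp])
  · rw [hh, List.take_length]
    exact hv

theorem take_eq_of_prefix {α : Type*} {l l' : List α} (h : l <+: l') {n : ℕ}
    (hn : n ≤ l.length) : l'.take n = l.take n := by
  obtain ⟨t, rfl⟩ := h
  exact List.take_append_of_le_length hn

theorem Backed.step {v : Node} {now : ℝ} {c : Command Node}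
    {s s' : NodeState Node Block Hash Sig} {out : Outbox Node Block Hash Sig} {B : Block}
    (hB : S.Backed v s B) (h : S.LocalStep v now c s s' out) (hs : S.WellFormed v s) :
    S.Backed v s' B := by
  have hlen := h.chain_prefix.length_le
  have htake := take_eq_of_prefix h.chain_prefix hB.le
  refine ⟨hB.le.trans hlen, htake ▸ hB.validator, htake ▸ hB.validNext, fun heq => ?_⟩
  have hle := hB.le
  obtain ⟨p, hp, hl⟩ := hB.locked (by omega)
  exact h.locked hs (by omega) hp hl

/-- The seal has occurred in a message sent so far. -/
def SealSent (σ : Config Node Block Hash Sig) (cs : Sig) : Prop :=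
  ∃ m, σ.Sent m ∧ cs ∈ m.seals

/-- Invariant of the reachable configurations. -/
structure Invariant (S : Setting Node Block Tx Hash Sig) (byz : Set Node)
    (σ : Config Node Block Hash Sig) : Prop where
  wellFormed : ∀ v ∉ byz, S.WellFormed v (σ.node v)
  received : ∀ v, ∀ m ∈ (σ.node v).received, σ.Sent m
  backed : ∀ v ∉ byz, ∀ H, SealSent σ (S.sign H v) → ∃ B, H = S.keccak B ∧ S.Backed v (σ.node v) B
  unique : ∀ v ∉ byz, ∀ B B', SealSent σ (S.sign (S.keccak B) v) →
    SealSent σ (S.sign (S.keccak B') v) → S.height B = S.height B' → B = B'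
  commit : ∀ v ∉ byz, ∀ h r H cs, σ.Sent (.signed (.commit h r H cs) v) →
    ∃ B, H = S.keccak B ∧ S.height B = h

theorem invariant_initial (byz : Set Node) :
    S.Invariant byz (Config.initial Node Block Hash Sig) := by
  have hsent : ∀ m, ¬ (Config.initial Node Block Hash Sig).Sent m := by
    rintro m ⟨p, hp, -⟩
    exact hp
  refine ⟨fun v _ => ?_, fun v m hm => absurd hm (Set.notMem_empty _), ?_, ?_, ?_⟩
  · constructor <;> simp [Config.initial]
  · rintro v - H ⟨m, hm, -⟩
    exact absurd hm (hsent m)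
  · rintro v - B B' ⟨m, hm, -⟩
    exact absurd hm (hsent m)
  · intro v _ h r H cs hm
    exact absurd hm (hsent _)

/-- The invariant survives a change that leaves the local states alone, apart from additional received
messages, and brings neither a new seal nor a new signed message of an honest node. -/
theorem Invariant.of_no_new_seal {byz : Set Node} {σ σ' : Config Node Block Hash Sig}
    (hσ : S.Invariant byz σ)
    (hchain : ∀ v, (σ'.node v).chain = (σ.node v).chain)
    (hstatus : ∀ v, (σ'.node v).status = (σ.node v).status)
    (hrec : ∀ v, (σ.node v).received ⊆ (σ'.node v).received)
    (hsent : ∀ v, ∀ m ∈ (σ'.node v).received, σ'.Sent m)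
    (hseal : ∀ v ∉ byz, ∀ H, SealSent σ' (S.sign H v) → SealSent σ (S.sign H v))
    (hsigned : ∀ v ∉ byz, ∀ c, σ'.Sent (.signed c v) → σ.Sent (.signed c v)) :
    S.Invariant byz σ' := by
  refine ⟨fun v hv => ?_, hsent, fun v hv H hH => ?_, fun v hv B B' hB hB' =>
    hσ.unique v hv B B' (hseal v hv _ hB) (hseal v hv _ hB'), fun v hv h r H cs hc =>
    hσ.commit v hv h r H cs (hsigned v hv _ hc)⟩
  · have hw := hσ.wellFormed v hv
    constructor
    · rw [hchain]
      exact hw.head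
    · rw [hchain]
      exact hw.height
    · rw [hchain]
      exact fun i FB hi hFB => hrec v (hw.received i FB hi hFB)
    · rw [hchain]
      exact hw.valid
    · rw [hchain, hstatus]
      exact hw.validator
    · rw [hchain, hstatus]
      exact hw.running
  · obtain ⟨B, rfl, hB⟩ := hσ.backed v hv H (hseal v hv H hH)
    refine ⟨B, rfl, ?_⟩
    obtain ⟨h1, h2, h3, h4⟩ := hB
    rw [← hchain] at h1 h2 h3 h4
    rw [← hstatus] at h4
    exact ⟨h1, h2, h3, h4⟩

theorem Invariant.step_command {byz : Set Node} {σ : Config Node Block Hash Sig}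
    (hσ : S.Invariant byz σ) {v : Node} (honest : v ∉ byz) {t now : ℝ} {c : Command Node}
    {s : NodeState Node Block Hash Sig} {out : Outbox Node Block Hash Sig}
    (step : S.LocalStep v now c (σ.node v) s out) : S.Invariant byz (σ.update v t s out) := by
  have hw := hσ.wellFormed v honest
  have hself : (σ.update v t s out).node v = s := by simp [Config.update]
  have hother : ∀ u, u ≠ v → (σ.update v t s out).node u = σ.node u := by
    intro u hu
    simp [Config.update, hu]
  have hsent : ∀ m, (σ.update v t s out).Sent m → σ.Sent m ∨ S.Sendable v (σ.node v) m := by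
    rintro m ⟨p, hp | hp, rfl⟩
    · exact Or.inl ⟨p, hp, rfl⟩
    · exact Or.inr (step.sendable hw hp.1)
  -- A seal that is new has been made by `v`, of the block on which it is locked.
  have hseal : ∀ cs, SealSent (σ.update v t s out) cs → SealSent σ cs ∨
      ∃ p B, (σ.node v).status = .running p ∧ p.lockedBlock = some B ∧
        cs = S.sign (S.keccak B) v := by
    rintro cs ⟨m, hm, hcs⟩
    rcases hsent m hm with hm | hm
    · exact Or.inl ⟨m, hm, hcs⟩
    · match m, hcs, hm with
      | .signed (.commit h r H cs') u, hcs, hm =>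
        obtain ⟨p, B, hp, hB, -, rfl, rfl⟩ := hm.commit _ _ _ _ _ rfl
        exact Or.inr ⟨p, B, hp, hB, hcs⟩
      | .finalisedBlock FB, hcs, hm =>
        obtain ⟨m', hm', hcs'⟩ := hm.proof FB cs rfl hcs
        exact Or.inl ⟨m', hσ.received _ _ hm', hcs'⟩
  have hmono : ∀ m, σ.Sent m → (σ.update v t s out).Sent m := by
    rintro m ⟨p, hp, rfl⟩
    exact ⟨p, Or.inl hp, rfl⟩
  -- Whichever of the two cases holds, the state before the step backs the seal.
  have hbacked : ∀ u ∉ byz, ∀ H, SealSent (σ.update v t s out) (S.sign H u) →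
      ∃ B, H = S.keccak B ∧ S.Backed u (σ.node u) B := by
    intro u hu H hH
    rcases hseal _ hH with h | ⟨p, B, hp, hB, heq⟩
    · exact hσ.backed u hu H h
    · obtain ⟨rfl, rfl⟩ := sign_eq_sign_iff.1 heq
      exact ⟨B, rfl, Backed.of_locked hw hp hB⟩
  have hbacked' : ∀ u ∉ byz, ∀ B, SealSent (σ.update v t s out) (S.sign (S.keccak B) u) →
      S.Backed u (σ.node u) B := by
    intro u hu B hB
    obtain ⟨B', heq, hB'⟩ := hbacked u hu _ hB
    exact S.keccak_injective heq ▸ hB'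
  -- A block newly sealed by `v` has the height of the running instance, so that the lock of `v`
  -- identifies it with any other block of this height sealed by `v`.
  have hnew : ∀ {p B B'}, (σ.node v).status = .running p → p.lockedBlock = some B →
      S.height B = S.height B' → S.Backed v (σ.node v) B' → B = B' := by
    intro p B B' hp hB hh hB'
    have hlen := hw.height_of_validNext ((hw.running _ hp).locked _ hB)
    obtain ⟨p', hp', hl⟩ := hB'.locked (hh ▸ hlen)
    obtain rfl : p = p' := by simpa using hp.symm.trans hp'
    exact Option.some.inj (hB.symm.trans hl)
  refine ⟨fun u hu => ?_, fun u m hm => ?_, fun u hu H hH => ?_, fun u hu B B' hB hB' hh => ?_,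
    fun u hu h r H cs hc => ?_⟩
  · by_cases huv : u = v
    · subst huv
      rw [hself]
      exact step.wellFormed hw
    · rw [hother u huv]
      exact hσ.wellFormed u hu
  · apply hmono
    by_cases huv : u = v
    · subst huv
      rw [hself, step.received_eq] at hm
      exact hσ.received _ _ hm
    · rw [hother u huv] at hm
      exact hσ.received _ _ hm
  · obtain ⟨B, hHB, hB⟩ := hbacked u hu H hH
    refine ⟨B, hHB, ?_⟩
    by_cases huv : u = v
    · subst huv
      rw [hself]
      exact hB.step step hw
    · rw [hother u huv]
      exact hB
  · have hb := hbacked' u hu B hB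
    have hb' := hbacked' u hu B' hB'
    rcases hseal _ hB with h | ⟨p, B₁, hp, hl, heq⟩
    · rcases hseal _ hB' with h' | ⟨p, B₁, hp, hl, heq⟩
      · exact hσ.unique u hu B B' h h' hh
      · obtain ⟨hk, rfl⟩ := sign_eq_sign_iff.1 heq
        obtain rfl := S.keccak_injective hk
        exact (hnew hp hl hh.symm hb).symm
    · obtain ⟨hk, rfl⟩ := sign_eq_sign_iff.1 heq
      obtain rfl := S.keccak_injective hk
      exact hnew hp hl hh hb'
  · rcases hsent _ hc with hc | hc
    · exact hσ.commit u hu h r H cs hc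
    · obtain ⟨p, B, hp, hB, rfl, rfl, -⟩ := hc.commit _ _ _ _ _ rfl
      exact ⟨B, rfl, hw.height_of_validNext ((hw.running _ hp).locked _ hB)⟩

theorem Invariant.step {byz : Set Node} {t : ℝ} {now : Node → ℝ}
    {a : Action Node Block Hash Sig} {σ σ' : Config Node Block Hash Sig}
    (hσ : S.Invariant byz σ) (h : S.Step byz t now a σ σ') : S.Invariant byz σ' := by
  cases h with
  | command _ v c s out honest step => exact hσ.step_command honest step
  | deliver _ D sub =>
    refine hσ.of_no_new_seal (fun _ => rfl) (fun _ => rfl) (fun _ => Set.subset_union_left) ?_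
      (fun _ _ _ h => h) (fun _ _ _ h => h)
    rintro v m (hm | ⟨p, hp, -, rfl⟩)
    · exact hσ.received v m hm
    · exact ⟨p, sub hp, rfl⟩
  | byzantine _ b p mem time_eq forge =>
    refine hσ.of_no_new_seal (fun _ => rfl) (fun _ => rfl) (fun _ => subset_rfl) ?_ ?_ ?_
    · intro v m hm
      obtain ⟨q, hq, rfl⟩ := hσ.received v m hm
      exact ⟨q, Or.inr hq, rfl⟩
    · rintro v hv H ⟨m, ⟨q, rfl | hq, rfl⟩, hm⟩
      · exact forge.2 H v hv hm
      · exact ⟨_, ⟨q, hq, rfl⟩, hm⟩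
    · rintro v hv c ⟨q, rfl | hq, hqc⟩
      · exact hqc ▸ (forge.1 c v hqc).resolve_left hv
      · exact ⟨q, hq, hqc⟩
  | idle => exact hσ

theorem Run.invariant {byz : Set Node} (ρ : S.Run byz) (n : ℕ) : S.Invariant byz (ρ.cfg n) := by
  induction n with
  | zero => exact ρ.cfg_zero ▸ invariant_initial byz
  | succ n ih => exact ih.step (ρ.step n)

/-! ### Monotonicity along a run -/

theorem Run.sent_mono {byz : Set Node} (ρ : S.Run byz) : Monotone fun n => (ρ.cfg n).sent := by
  refine monotone_nat_of_le_succ fun n => ?_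
  have h := ρ.step n
  revert h
  generalize ρ.act n = a
  generalize ρ.cfg n = σ
  generalize ρ.cfg (n + 1) = σ'
  intro h
  cases h with
  | command => exact Set.subset_union_left
  | byzantine => exact Set.subset_insert _ _
  | _ => exact subset_rfl

theorem Run.received_mono {byz : Set Node} (ρ : S.Run byz) (v : Node) :
    Monotone fun n => ((ρ.cfg n).node v).received := by
  refine monotone_nat_of_le_succ fun n => ?_
  have h := ρ.step n
  revert h
  generalize ρ.act n = a
  generalize ρ.cfg n = σ
  generalize ρ.cfg (n + 1) = σ'
  intro h
  cases h with
  | command _ u c s out _ step =>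
    by_cases huv : v = u
    · subst huv
      simp [Config.update, step.received_eq]
    · simp [Config.update, huv]
  | deliver => exact Set.subset_union_left
  | _ => exact subset_rfl

theorem Run.chain_prefix {byz : Set Node} (ρ : S.Run byz) (v : Node) {n n' : ℕ} (hn : n ≤ n') :
    ((ρ.cfg n).node v).chain <+: ((ρ.cfg n').node v).chain := by
  induction n', hn using Nat.le_induction with
  | base => exact List.prefix_rfl
  | succ n' _ ih =>
    refine ih.trans ?_
    have h := ρ.step n'
    revert h
    generalize ρ.act n' = a
    generalize ρ.cfg n' = σ
    generalize ρ.cfg (n' + 1) = σ'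
    intro h
    cases h with
    | command _ u c s out _ step =>
      by_cases huv : v = u
      · subst huv
        simpa [Config.update] using step.chain_prefix
      · simp [Config.update, huv]
    | _ => exact List.prefix_rfl

theorem Run.sent_of_le {byz : Set Node} (ρ : S.Run byz) {n n' : ℕ} (hn : n ≤ n')
    {m : Msg Node Block Hash Sig} (h : (ρ.cfg n).Sent m) : (ρ.cfg n').Sent m := by
  obtain ⟨p, hp, hm⟩ := h
  exact ⟨p, ρ.sent_mono hn hp, hm⟩

/-- A command of an honest node, spelled out. -/
theorem Run.step_of_command {byz : Set Node} (ρ : S.Run byz) {n : ℕ} {v : Node} {c : Command Node}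
    (h : ρ.act n = .command v c) : ∃ s out,
      S.LocalStep v (ρ.clock v (ρ.time n)) c ((ρ.cfg n).node v) s out ∧
      ρ.cfg (n + 1) = (ρ.cfg n).update v (ρ.time n) s out := by
  have hstep := ρ.step n
  rw [h] at hstep
  generalize ρ.cfg (n + 1) = σ' at hstep ⊢
  cases hstep with
  | command _ _ _ s out _ step => exact ⟨s, out, step, rfl⟩

theorem Run.step_of_deliver {byz : Set Node} (ρ : S.Run byz) {n : ℕ}
    {D : Set (Packet Node Block Hash Sig)} (h : ρ.act n = .deliver D) :
    D ⊆ (ρ.cfg n).sent ∧ ρ.cfg (n + 1) = (ρ.cfg n).deliver D := by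
  have hstep := ρ.step n
  rw [h] at hstep
  generalize ρ.cfg (n + 1) = σ' at hstep ⊢
  cases hstep with
  | deliver _ _ sub => exact ⟨sub, rfl⟩

/-- Every packet bears the time of an earlier step. -/
theorem Run.exists_time_eq {byz : Set Node} (ρ : S.Run byz) {n : ℕ}
    {p : Packet Node Block Hash Sig} (hp : p ∈ (ρ.cfg n).sent) : ∃ j < n, p.time = ρ.time j := by
  induction n with
  | zero =>
    rw [ρ.cfg_zero] at hp
    exact absurd hp (Set.notMem_empty _)
  | succ n ih =>
    by_cases hpn : p ∈ (ρ.cfg n).sent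
    · obtain ⟨j, hj, h⟩ := ih hpn
      exact ⟨j, by omega, h⟩
    · refine ⟨n, by omega, ?_⟩
      have h := ρ.step n
      revert h hp hpn
      generalize ρ.act n = a
      generalize ρ.cfg n = σ
      generalize ρ.cfg (n + 1) = σ'
      intro hp hpn h
      cases h with
      | command _ u c s out _ step => exact (hp.resolve_left hpn).2
      | deliver => exact absurd hp hpn
      | byzantine _ b q mem time_eq forge =>
        obtain rfl := hp.resolve_right hpn
        exact time_eq
      | idle => exact absurd hp hpn

/-! ### Safety -/

/-- Two finalised blocks of one height have a common honest signer, and it seals one block only. -/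
theorem Invariant.block_eq {byz : Set Node} {σ : Config Node Block Hash Sig}
    (hσ : S.Invariant byz σ) {V : Finset Node} (hbyz : byzCount byz V ≤ maxFaulty V.card)
    {FB FB' : FinalisedBlock Block Sig} (h : σ.Sent (.finalisedBlock FB))
    (h' : σ.Sent (.finalisedBlock FB')) (hh : S.height FB.block = S.height FB'.block)
    (hp : S.ValidFinalisationProof V FB) (hp' : S.ValidFinalisationProof V FB') :
    FB.block = FB'.block := by
  obtain ⟨v, hv, hv', hhonest⟩ := exists_honest_of_quorums hbyz (fun v hv => hv.1)
    (fun v hv => hv.1) (validFinalisationProof_iff.1 hp) (validFinalisationProof_iff.1 hp')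
  exact hσ.unique v hhonest _ _ ⟨_, h, hv.2⟩ ⟨_, h', hv'.2⟩ hh

theorem optimalPersistenceThreshold (S : Setting Node Block Tx Hash Sig) :
    S.OptimalPersistenceThreshold := by
  intro h _ byz ρ V hagree hbyz n
  have hσ := ρ.invariant n
  refine ⟨fun FB hFB => ?_, fun FB FB' hs hs' hh hh' hp hp' =>
    hσ.block_eq hbyz hs hs' (hh.trans hh'.symm) hp hp'⟩
  obtain ⟨hsent, hQ⟩ := hFB
  obtain ⟨v, ⟨-, cs, hcs, hrec, r, hcommit⟩, -, hv⟩ :=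
    exists_honest_of_quorums hbyz (fun v hv => hv.1) (fun v hv => hv.1) hQ hQ
  obtain rfl := (S.recover_eq_some_iff _ _ _).1 hrec
  obtain ⟨B, hB, rfl⟩ := hσ.commit v hv _ _ _ _ hcommit
  obtain ⟨B', hB', hback⟩ := hσ.backed v hv _ ⟨_, hsent, hcs⟩
  obtain rfl := S.keccak_injective hB
  obtain rfl := S.keccak_injective hB'
  refine ⟨rfl, v, hv, hback.le, ?_, hback.validNext⟩
  rw [hagree n v hv hback.le hback.validator, validFinalisationProof_iff]
  refine hQ.trans (Set.ncard_le_ncard ?_ (V.finite_toSet.subset fun v hv => hv.1))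
  rintro u ⟨hu, cs, hcs, hrec, -⟩
  exact ⟨hu, (S.recover_eq_some_iff _ _ _).1 hrec ▸ hcs⟩

/-! ### Agreement of honest chains -/

/-- The chains of honest nodes contain the same blocks at all heights that both have reached. -/
theorem Run.blocks_agree {byz : Set Node} (ρ : S.Run byz) (hρ : ρ.FaultBound maxFaulty)
    {v v' : Node} (hv : v ∉ byz) (hv' : v' ∉ byz) (n n' : ℕ) (h : ℕ) :
    h ≤ ((ρ.cfg n).node v).chain.length → h ≤ ((ρ.cfg n').node v').chain.length →
    blocks (((ρ.cfg n).node v).chain.take h) = blocks (((ρ.cfg n').node v').chain.take h) := by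
  induction h with
  | zero => simp [blocks]
  | succ h ih =>
    intro hl hl'
    have ih := ih (by omega) (by omega)
    have hw := (ρ.invariant n).wellFormed v hv
    have hw' := (ρ.invariant n').wellFormed v' hv'
    obtain ⟨FB, hFB⟩ : ∃ FB, ((ρ.cfg n).node v).chain[h]? = some FB :=
      ⟨_, List.getElem?_eq_getElem (by omega)⟩
    obtain ⟨FB', hFB'⟩ : ∃ FB, ((ρ.cfg n').node v').chain[h]? = some FB :=
      ⟨_, List.getElem?_eq_getElem (by omega)⟩
    suffices heq : FB.block = FB'.block by
      simp only [blocks] at ih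
      simp [blocks, List.take_add_one, hFB, hFB', ih, heq]
    rcases Nat.eq_zero_or_pos h with rfl | hpos
    · rw [hw.head _ hFB, hw'.head _ hFB']
    · have hval' := (hw'.valid h FB' hpos hFB').1
      rw [← ih] at hval'
      exact (ρ.invariant (max n n')).block_eq (hρ n v hv h hpos (by omega))
        (ρ.sent_of_le (le_max_left n n')
          ((ρ.invariant n).received v _ (hw.received h FB hpos hFB)))
        (ρ.sent_of_le (le_max_right n n')
          ((ρ.invariant n').received v' _ (hw'.received h FB' hpos hFB')))
        ((hw.height h FB hFB).trans (hw'.height h FB' hFB').symm)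
        (hw.valid h FB hpos hFB).1 hval'

theorem Run.block_eq_of_getElem? {byz : Set Node} (ρ : S.Run byz) (hρ : ρ.FaultBound maxFaulty)
    {v v' : Node} (hv : v ∉ byz) (hv' : v' ∉ byz) {n n' h : ℕ} {FB FB' : FinalisedBlock Block Sig}
    (hFB : ((ρ.cfg n).node v).chain[h]? = some FB)
    (hFB' : ((ρ.cfg n').node v').chain[h]? = some FB') : FB.block = FB'.block := by
  have hl := (List.getElem?_eq_some_iff.1 hFB).1
  have hl' := (List.getElem?_eq_some_iff.1 hFB').1
  have heq := congrArg (·[h]?) (ρ.blocks_agree hρ hv hv' n n' (h + 1) hl hl')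
  simpa [blocks, List.getElem?_take, hFB, hFB'] using heq

/-! ### Liveness -/

theorem Run.exists_time_gt {byz : Set Node} (ρ : S.Run byz) (x : ℝ) (N : ℕ) :
    ∃ n, N ≤ n ∧ ∀ m, n ≤ m → x < ρ.time m := by
  obtain ⟨n, hn, hx⟩ := ((Filter.eventually_ge_atTop N).and
    (ρ.time_unbounded.eventually_gt_atTop x)).exists
  exact ⟨n, hn, fun m hm => hx.trans_le (ρ.time_mono hm)⟩

/-- If the honest node `v` has a block of height `i`, an honest node `v'` that never gets one
receives the one in the chain of `v` in answer to a query. -/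
theorem Run.exists_received {byz : Set Node} (ρ : S.Run byz) (hsync : ρ.EventuallySynchronous)
    (hlive : ρ.HonestNodesLive) {v v' : Node} (hv : v ∉ byz) (hv' : v' ∉ byz) {n n' i : ℕ}
    (hi : i < ((ρ.cfg n).node v).chain.length)
    (hstuck : ∀ m, n' ≤ m → ((ρ.cfg m).node v').chain.length = i) :
    ∃ k l FB, ((ρ.cfg l).node v).chain[i]? = some FB ∧
      .finalisedBlock FB ∈ ((ρ.cfg k).node v').received := by
  obtain ⟨GST, Δ, -, hdel⟩ := hsync
  obtain ⟨m₀, hm₀, htime⟩ := ρ.exists_time_gt (max GST (ρ.time n)) n'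
  obtain ⟨m₁, hm₁, hact₁⟩ := hlive.queries v' hv' m₀
  have ht₁ := max_lt_iff.1 (htime m₁ hm₁)
  let q : Packet Node Block Hash Sig := ⟨.query i v', v, ρ.time m₁⟩
  have hq : q ∈ (ρ.cfg (m₁ + 1)).sent := by
    obtain ⟨s, out, step, heq⟩ := ρ.step_of_command hact₁
    rw [heq]
    refine Or.inr ⟨?_, rfl⟩
    cases step with
    | fp _ _ _ _ _ _ step => cases step
    | query =>
      rw [hstuck m₁ (hm₀.trans hm₁)]
      exact ⟨rfl, Set.mem_univ _⟩
  obtain ⟨m₂, D, hact₂, hqD, -⟩ := hdel _ q hq ht₁.1.le hv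
  -- Packets are identified by content and time, so the delivery need not come after step `m₁`, but
  -- it comes after a step of the same real time, hence after step `n`.
  obtain ⟨j, hj, htj⟩ := ρ.exists_time_eq ((ρ.step_of_deliver hact₂).1 hqD)
  have htj' : ρ.time m₁ = ρ.time j := htj
  have hnj : n < j := ρ.time_mono.reflect_lt (htj' ▸ ht₁.2)
  obtain ⟨m₃, hm₃, hact₃⟩ := hlive.replies v hv m₂ D q i v' hact₂ hqD rfl rfl
    (hi.trans_le (ρ.chain_prefix v (by omega)).length_le)
  obtain ⟨s, out, step, heq⟩ := ρ.step_of_command hact₃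
  cases step with
  | fp _ _ _ _ _ _ step => cases step
  | reply _ _ _ FB mem available =>
    let a : Packet Node Block Hash Sig := ⟨.finalisedBlock FB, v', ρ.time m₃⟩
    have ha : a ∈ (ρ.cfg (m₃ + 1)).sent := by
      rw [heq]
      exact Or.inr ⟨⟨rfl, rfl⟩, rfl⟩
    have ht₃ : ρ.time m₁ ≤ ρ.time m₃ := htj' ▸ ρ.time_mono (by omega)
    obtain ⟨m₄, D', hact₄, haD, -⟩ := hdel _ a ha (ht₁.1.le.trans ht₃) hv'
    refine ⟨m₄ + 1, m₃, FB, available, ?_⟩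
    rw [(ρ.step_of_deliver hact₄).2]
    exact Or.inr ⟨a, haD, rfl, rfl⟩

/-- Every honest node eventually gets a chain as long as that of any other honest node. -/
theorem Run.exists_length_gt {byz : Set Node} (ρ : S.Run byz) (hρ : ρ.FaultBound maxFaulty)
    (hsync : ρ.EventuallySynchronous) (hlive : ρ.HonestNodesLive) {v v' : Node} (hv : v ∉ byz)
    (hv' : v' ∉ byz) {n : ℕ} (i : ℕ) :
    i < ((ρ.cfg n).node v).chain.length → ∃ n', i < ((ρ.cfg n').node v').chain.length := by
  induction i with
  | zero =>
    intro _
    obtain ⟨m, hm⟩ := hlive.starts v' hv'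
    obtain ⟨s, out, step, heq⟩ := ρ.step_of_command hm
    refine ⟨m + 1, ?_⟩
    rw [heq]
    cases step with
    | fp _ _ _ _ _ _ step => cases step
    | ibftInit => simp [Config.update]
  | succ i ih =>
    intro hi
    obtain ⟨n', hn'⟩ := ih (by omega)
    by_contra! hcon
    have hstuck : ∀ m, n' ≤ m → ((ρ.cfg m).node v').chain.length = i + 1 := fun m hm =>
      le_antisymm (hcon m) (hn'.trans_le (ρ.chain_prefix v' hm).length_le)
    obtain ⟨k, l, FB, hFB, hrec⟩ := ρ.exists_received hsync hlive hv hv' hi hstuck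
    have hw := (ρ.invariant l).wellFormed v hv
    obtain ⟨m, hm, hact⟩ := hlive.adds v' hv' (max n' k) fun m hm => by
      have hlen := hstuck m (by omega)
      refine ⟨_, _, .igc1 _ FB (List.ne_nil_of_length_pos (by omega))
        (ρ.received_mono v' (by omega : k ≤ m) hrec)
        (by rw [hlen, hw.height _ _ hFB])
        ((hw.valid _ _ (by omega) hFB).congr_blocks ?_)⟩
      have hl := (List.getElem?_eq_some_iff.1 hFB).1
      rw [ρ.blocks_agree hρ hv hv' l m (i + 1) hl.le hlen.ge, ← hlen, List.take_length]
    obtain ⟨s, out, step, heq⟩ := ρ.step_of_command hact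
    have hlen := hstuck m (by omega)
    have hlen' := hstuck (m + 1) (by omega)
    rw [heq] at hlen'
    cases step with
    | fp _ _ _ _ _ _ step => cases step
    | igc1 =>
      simp [Config.update] at hlen'
      omega

theorem tolerantPersistence (S : Setting Node Block Tx Hash Sig) :
    S.TolerantPersistence maxFaulty := by
  rintro byz ρ hρ n v hv h k T ⟨FB, hFB, hT⟩
  refine ⟨?_, fun hsync hlive v' hv' => ?_⟩
  · rintro n' v' hv' T' ⟨FB', hFB', hT'⟩
    rw [← ρ.block_eq_of_getElem? hρ hv hv' hFB hFB'] at hT'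
    exact Option.some.inj (hT'.symm.trans hT)
  · obtain ⟨n', hn'⟩ := ρ.exists_length_gt hρ hsync hlive hv hv' h
      (List.getElem?_eq_some_iff.1 hFB).1
    have hFB' := List.getElem?_eq_getElem hn'
    exact ⟨n', _, hFB', ρ.block_eq_of_getElem? hρ hv hv' hFB hFB' ▸ hT⟩

end Setting

end IBFT

theorem mainTheorem3 {Node Block Tx Hash Sig : Type*}
    (S : IBFT.Setting Node Block Tx Hash Sig) :
    S.OptimalPersistenceThreshold ∧ S.TolerantPersistence IBFT.maxFaulty :=
  ⟨S.optimalPersistenceThreshold, S.tolerantPersistence⟩
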